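/- Let $Q_n$ be the $n$-dimensional hypercube graph: its vertices are the $2^n$ binary $n$-tuples, and two vertices are adjacent if and only if they differ in exactly one coordinate. A decomposition of a graph $G$ is a collection of subgraphs of $G$ such that every edge of $G$ belongs to exactly one of them. Let $n \ge 2$ be an even integer, and let $m$ be the largest integer with $2^m \le n$. Then, for every $r = 1, 2, \ldots, m$, the graph $Q_n$ has a decomposition all of whose members are cycles with exactly $2^r n$ edges. -/

import Mathlib

namespace CubeDecomposition

/-- The `n`-cube `Q_n`: its vertices are the binary `n`-tuples, two of them being adjacent
if and only if they differ in exactly one coordinate. -/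
def cube (n : ℕ) : SimpleGraph (Fin n → Bool) where
  Adj x y := ∃! i, x i ≠ y i
  symm := ⟨by
    rintro x y ⟨i, hi, h⟩
    exact ⟨i, hi.symm, fun j hj => h j hj.symm⟩⟩
  loopless := ⟨by
    rintro x ⟨i, hi, -⟩
    exact hi rfl⟩

/-- A collection `S` of subgraphs of `G` is a decomposition of `G` if every edge of `G` belongs to
exactly one member of `S`. Since every edge of a subgraph is an edge of `G`, the members of `S`
are then pairwise edge-disjoint. -/
def IsDecomposition {V : Type*} (G : SimpleGraph V) (S : Set G.Subgraph) : Prop :=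
  ∀ e ∈ G.edgeSet, ∃! K : G.Subgraph, K ∈ S ∧ e ∈ K.edgeSet

/-- `G` can be decomposed into `H`: it has a decomposition all of whose members are
isomorphic to `H`. -/
def DecomposesInto {V W : Type*} (G : SimpleGraph V) (H : SimpleGraph W) : Prop :=
  ∃ S : Set G.Subgraph, IsDecomposition G S ∧ ∀ K ∈ S, Nonempty (K.coe ≃g H)

end CubeDecomposition

set_option linter.unusedSectionVars false

/-! Identify the vertices of `Q_n` with vectors over `ZMod 2`, and let a linear map to an elementary
abelian group `A` of order `2 ^ (r + 1)` send the `i`-th unit vector to a nonzero step `a i`. Edges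
of direction `i` then lie over the edges `{y, y + a i}` labelled `i` of a Cayley multigraph of `A`,
which has `2 ^ r * n` edges in all. Suppose that a word is an Eulerian tour of this multigraph, and
that the same word, read in the cube, traces a cycle. The translates of this cycle by the kernel
decompose `Q_n`: an edge of the cube fixes, through its image, the moment at which the tour passes
below it, and this moment fixes the translation (`IsTour.decomposesInto`).

It remains to find such tours for all even `n ≥ 2 ^ r`. `IsTour.addPair` gives two new labels the
step of an old one, so `n` grows by 2 and `A` stays. `IsTour.double` replaces `A` by `A × ZMod 2`
and adds `n` labels that all switch the layer, so `n` doubles and `r` grows by 1. Explicit tours for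
`(n, r) = (2, 1)` and `(4, 2)` start the induction: doubling reaches `n = 2 ^ r`, and adding pairs
reaches the rest. -/

namespace CubeDecomposition


/-! ### Walks described by words, and the counting of their arcs. -/

section Walk

variable {ι G H : Type*} [AddCommGroup G] [AddCommGroup H]

/-- The arcs (label, starting point) of the walk from `x` whose steps are labelled by the word `l`,
a step with label `i` being a translation by `a i`. -/
def arcs (a : ι → G) : G → List ι → List (ι × G)
  | _, [] => []
  | x, i :: l => (i, x) :: arcs a (x + a i) l

/-- The successive points of a walk, except for its end point. -/
def points (a : ι → G) (x : G) (l : List ι) : List G := (arcs a x l).map Prod.snd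

@[simp] theorem arcs_nil (a : ι → G) (x : G) : arcs a x [] = [] := rfl

@[simp] theorem arcs_cons (a : ι → G) (x : G) (i : ι) (l : List ι) :
    arcs a x (i :: l) = (i, x) :: arcs a (x + a i) l := rfl

@[simp] theorem points_nil (a : ι → G) (x : G) : points a x [] = [] := rfl

@[simp] theorem points_cons (a : ι → G) (x : G) (i : ι) (l : List ι) :
    points a x (i :: l) = x :: points a (x + a i) l := rfl

theorem arcs_append (a : ι → G) (x : G) (l l' : List ι) :
    arcs a x (l ++ l') = arcs a x l ++ arcs a (x + (l.map a).sum) l' := by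
  induction l generalizing x with
  | nil => simp
  | cons i l ih => simp [ih, add_assoc]

theorem points_append (a : ι → G) (x : G) (l l' : List ι) :
    points a x (l ++ l') = points a x l ++ points a (x + (l.map a).sum) l' := by
  simp [points, arcs_append]

@[simp] theorem length_arcs (a : ι → G) (x : G) (l : List ι) : (arcs a x l).length = l.length := by
  induction l generalizing x with
  | nil => rfl
  | cons i l ih => simp [ih]

theorem getElem_arcs (a : ι → G) (x : G) (l : List ι) (t : ℕ) (ht : t < l.length) :
    (arcs a x l)[t]'(by simpa using ht) = (l[t], x + ((l.take t).map a).sum) := by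
  induction l generalizing x t with
  | nil => simp at ht
  | cons i l ih =>
    cases t with
    | zero => simp
    | succ t =>
      simp only [arcs_cons, List.getElem_cons_succ]
      rw [ih _ _ (by simpa using ht)]
      simp [add_assoc]

theorem map_points (f : G →+ H) (a : ι → G) (x : G) (l : List ι) :
    (points a x l).map f = points (fun i => f (a i)) (f x) l := by
  induction l generalizing x with
  | nil => rfl
  | cons i l ih => simp [ih]

/-- The number of occurrences of the arc with label `i` and starting point `y`. -/
def tally [DecidableEq ι] [DecidableEq G] (i : ι) (y : G) (L : List (ι × G)) : ℕ :=
  L.count (i, y)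

section Tally

variable [DecidableEq ι] [DecidableEq G]

@[simp] theorem tally_nil (i : ι) (y : G) : tally i y [] = 0 := rfl

@[simp] theorem tally_cons (i j : ι) (x y : G) (L : List (ι × G)) :
    tally i y ((j, x) :: L) = tally i y L + if j = i ∧ x = y then 1 else 0 := by
  simp [tally, List.count_cons]

theorem tally_append (i : ι) (y : G) (L L' : List (ι × G)) :
    tally i y (L ++ L') = tally i y L + tally i y L' := List.count_append

theorem tally_pos_iff {i : ι} {y : G} {L : List (ι × G)} : 0 < tally i y L ↔ (i, y) ∈ L :=
  List.count_pos_iff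

theorem sum_tally_arcs [Fintype G] (a : ι → G) (x : G)
    (l : List ι) (i : ι) : ∑ y, tally i y (arcs a x l) = l.count i := by
  induction l generalizing x with
  | nil => simp
  | cons j l ih =>
    simp only [arcs_cons, tally_cons, Finset.sum_add_distrib, ih]
    by_cases h : j = i <;> simp [h]

end Tally

end Walk

/-- The indicator vector of a label. -/
def unitVec {ι : Type*} [DecidableEq ι] (i : ι) : ι → ZMod 2 := Pi.single i 1

/-- A word `w` is a tour with respect to the steps `a` if the walk that it describes passes exactly
once through every edge `{y, y + a i}` with label `i`, and if the corresponding walk on the cube is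
closed and does not visit a vertex twice. -/
structure IsTour {ι A : Type*} [DecidableEq ι] [AddCommGroup A] [DecidableEq A]
    (a : ι → A) (w : List ι) : Prop where
  step_ne_zero : ∀ i, a i ≠ 0
  tally_arcs : ∀ i y, tally i y (arcs a 0 w) + tally i (y + a i) (arcs a 0 w) = 1
  closed : (w.map unitVec).sum = 0
  simple : (points unitVec 0 w).Nodup

/-! ### From a tour in `A` to times and positions on a closed walk in the cube. -/

section Realization

variable {ι A : Type*} [Fintype ι] [DecidableEq ι] [AddCommGroup A] [Module (ZMod 2) A]

/-- The linear map that sends the indicator vector of `i` to `a i`. -/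
def project (a : ι → A) : (ι → ZMod 2) →+ A where
  toFun v := ∑ i, v i • a i
  map_zero' := by simp
  map_add' v v' := by simp [add_smul, Finset.sum_add_distrib]

@[simp] theorem project_unitVec (a : ι → A) (i : ι) : project a (unitVec i) = a i := by
  simp [project, unitVec, Pi.single_apply, ite_smul]

theorem project_sum (a : ι → A) (l : List ι) :
    project a (l.map unitVec).sum = (l.map a).sum := by
  induction l with
  | nil => simp
  | cons i l ih => simp [ih]

variable [DecidableEq A] {a : ι → A} {w : List ι}

/-- Summing the tour condition over `y` counts every arc labelled `i` twice, since translation by `a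
i` permutes `A`. -/
theorem IsTour.two_mul_count [Fintype A] (h : IsTour a w) (i : ι) :
    2 * w.count i = Fintype.card A := by
  have h1 : ∑ y : A, (tally i y (arcs a 0 w) + tally i (y + a i) (arcs a 0 w)) =
      Fintype.card A := by simp [h.tally_arcs]
  have h2 := Equiv.sum_comp (Equiv.addRight (a i)) (fun y => tally i y (arcs a 0 w))
  simp only [Equiv.coe_addRight] at h2
  rw [Finset.sum_add_distrib, h2, sum_tally_arcs] at h1
  omega

theorem IsTour.two_mul_length [Fintype A] (h : IsTour a w) :
    2 * w.length = Fintype.card A * Fintype.card ι := by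
  have h1 : ∑ i, w.count i = w.length := by
    have := Multiset.sum_count_eq_card (s := Finset.univ) (m := (w : Multiset ι)) (by simp)
    simpa using this
  rw [← h1, Finset.mul_sum]
  simp [h.two_mul_count, mul_comm]

theorem IsTour.sum_eq_zero (h : IsTour a w) : (w.map a).sum = 0 := by
  rw [← project_sum, h.closed, map_zero]

/-- The point of the closed walk reached after `t` steps. -/
def position (w : List ι) (t : ℕ) : ι → ZMod 2 := ((w.take t).map unitVec).sum

theorem position_succ (w : List ι) {t : ℕ} (ht : t < w.length) :
    position w (t + 1) = position w t + unitVec w[t] := by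
  rw [position, ← List.take_concat_get' w t ht, List.map_append, List.sum_append]
  simp [position]

theorem IsTour.position_injective (h : IsTour a w) {s t : ℕ} (hs : s < w.length)
    (ht : t < w.length) (hst : position w s = position w t) : s = t := by
  have h1 : ∀ u (hu : u < w.length),
      (points unitVec 0 w)[u]'(by simpa [points] using hu) = position w u := by
    intro u hu
    simp [points, getElem_arcs _ _ _ _ hu, position]
  refine (List.Nodup.getElem_inj_iff h.simple (hi := by simpa [points] using hs)
    (hj := by simpa [points] using ht)).1 ?_
  rw [h1 s hs, h1 t ht, hst]

theorem IsTour.exists_step (h : IsTour a w) (i : ι) (y : A) :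
    ∃ t, ∃ ht : t < w.length, w[t] = i ∧
      (project a (position w t) = y ∨ project a (position w t) = y + a i) := by
  have key : ∀ z, (i, z) ∈ arcs a 0 w → ∃ t, ∃ ht : t < w.length, w[t] = i ∧
      project a (position w t) = z := by
    intro z hz
    obtain ⟨t, ht, e⟩ := List.getElem_of_mem hz
    have ht' : t < w.length := by simpa using ht
    rw [getElem_arcs _ _ _ _ ht'] at e
    simp only [Prod.mk.injEq, zero_add] at e
    exact ⟨t, ht', e.1, by rw [position, project_sum, e.2]⟩
  have hc := h.tally_arcs i y
  by_cases h0 : tally i y (arcs a 0 w) = 0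
  · obtain ⟨t, ht, e, e'⟩ := key (y + a i) (tally_pos_iff.1 (by omega))
    exact ⟨t, ht, e, .inr e'⟩
  · obtain ⟨t, ht, e, e'⟩ := key y (tally_pos_iff.1 (by omega))
    exact ⟨t, ht, e, .inl e'⟩

/-- With `IsTour.exists_step`, this says that each labelled edge of the quotient is passed at
exactly one time. A second pass, in either direction, would push the sum in `tally_arcs` above 1. -/
theorem IsTour.step_unique (h : IsTour a w) {s t : ℕ} (hs : s < w.length) (ht : t < w.length)
    (hl : w[s] = w[t])
    (hp : project a (position w s) = project a (position w t) ∨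
      project a (position w s) = project a (position w t) + a w[t]) : s = t := by
  have hget : ∀ u (hu : u < w.length),
      (arcs a 0 w)[u]'(by simpa using hu) = (w[u], project a (position w u)) := by
    intro u hu
    rw [getElem_arcs _ _ _ _ hu, position, project_sum, zero_add]
  have hmem : ∀ u (hu : u < w.length), 0 < tally w[u] (project a (position w u)) (arcs a 0 w) := by
    intro u hu
    rw [tally_pos_iff, ← hget u hu]
    exact List.getElem_mem _
  rcases hp with hp | hp
  · have hnd : (arcs a 0 w).Nodup := by
      rw [List.nodup_iff_count_le_one]
      rintro ⟨i, y⟩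
      have := h.tally_arcs i y
      change tally i y (arcs a 0 w) ≤ 1
      omega
    refine (List.Nodup.getElem_inj_iff hnd (hi := by simpa using hs)
      (hj := by simpa using ht)).1 ?_
    rw [hget s hs, hget t ht, hl, hp]
  · exfalso
    have h1 := hmem s hs
    have h2 := hmem t ht
    have h3 := h.tally_arcs w[t] (project a (position w t))
    rw [hl, hp] at h1
    omega

end Realization

/-! ### Translates of the cycle and the decomposition of the cube. -/

section Cube

variable {n : ℕ} {ι A : Type*} [Fintype ι] [DecidableEq ι] [AddCommGroup A] [Module (ZMod 2) A]
  [DecidableEq A] {a : ι → A} {w : List ι}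

/-- The identification of vectors over `ZMod 2` with binary tuples. -/
def toTuple (e : Fin n ≃ ι) (v : ι → ZMod 2) : Fin n → Bool := fun k => decide (v (e k) = 1)

theorem toTuple_injective (e : Fin n ≃ ι) : Function.Injective (toTuple e) := by
  intro u v h
  funext i
  have := congrFun h (e.symm i)
  simp only [toTuple, Equiv.apply_symm_apply] at this
  generalize u i = p at this
  generalize v i = q at this
  revert p q
  decide

theorem toTuple_surjective (e : Fin n ≃ ι) : Function.Surjective (toTuple e) := by
  intro x
  refine ⟨fun i => if x (e.symm i) then 1 else 0, ?_⟩
  funext k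
  cases h : x k <;> simp [toTuple, h]

theorem add_unitVec_add_unitVec (v : ι → ZMod 2) (i : ι) : v + unitVec i + unitVec i = v := by
  rw [add_assoc, ZModModule.add_self, add_zero]

theorem unitVec_injective : Function.Injective (unitVec : ι → ι → ZMod 2) := by
  intro i j h
  by_contra hij
  have := congrFun h i
  simp [unitVec, hij] at this

theorem cube_adj_toTuple (e : Fin n ≃ ι) (u v : ι → ZMod 2) :
    (cube n).Adj (toTuple e u) (toTuple e v) ↔ ∃ i, v = u + unitVec i := by
  have hne : ∀ p q : ZMod 2, decide (p = 1) ≠ decide (q = 1) ↔ q = p + 1 := by decide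
  have heq : ∀ p q : ZMod 2, ¬ decide (p = 1) ≠ decide (q = 1) ↔ q = p := by decide
  constructor
  · rintro ⟨k, hk, hu⟩
    refine ⟨e k, funext fun i => ?_⟩
    by_cases h : i = e k
    · subst h
      simpa [unitVec] using (hne _ _).1 hk
    · have h1 : ¬ toTuple e u (e.symm i) ≠ toTuple e v (e.symm i) :=
        fun hc => h (by rw [← hu _ hc, Equiv.apply_symm_apply])
      have h2 := (heq _ _).1 h1
      simpa [unitVec, Pi.single_apply, h] using h2
  · rintro ⟨i, rfl⟩
    refine ⟨e.symm i, (hne _ _).2 (by simp [unitVec]), fun k hk => ?_⟩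
    have h2 := (hne _ _).1 hk
    by_contra hc
    have : e k ≠ i := fun h => hc (by rw [← h, Equiv.symm_apply_apply])
    simp [unitVec, this] at h2

theorem cycleGraph_adj_iff {L : ℕ} (hL : 3 ≤ L) {s t : Fin L} :
    (SimpleGraph.cycleGraph L).Adj s t ↔
      (t : ℕ) = (s + 1) % L ∨ (s : ℕ) = (t + 1) % L := by
  have key : ∀ s t : Fin L, (s - t).val = 1 ↔ (s : ℕ) = (t + 1) % L := by
    intro s t
    rw [Fin.sub_def]
    have hs := s.2
    have ht := t.2
    simp only
    constructor
    · intro h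
      rcases Nat.lt_or_ge (L - t + s) L with h1 | h1
      · rw [Nat.mod_eq_of_lt h1] at h
        rw [show (t : ℕ) + 1 = L by omega, Nat.mod_self]
        omega
      · rw [Nat.mod_eq_sub_mod h1, Nat.mod_eq_of_lt (by omega)] at h
        rw [Nat.mod_eq_of_lt (by omega)]
        omega
    · intro h
      rcases Nat.lt_or_ge ((t : ℕ) + 1) L with h1 | h1
      · rw [Nat.mod_eq_of_lt h1] at h
        rw [Nat.mod_eq_sub_mod (by omega), Nat.mod_eq_of_lt (by omega)]
        omega
      · rw [show (t : ℕ) + 1 = L by omega, Nat.mod_self] at h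
        rw [Nat.mod_eq_of_lt (by omega)]
        omega
  rw [SimpleGraph.cycleGraph_adj', key, key, or_comm]

theorem IsTour.position_mod (h : IsTour a w) {t : ℕ} (ht : t < w.length) :
    position w ((t + 1) % w.length) = position w t + unitVec w[t] := by
  rw [← position_succ w ht]
  rcases Nat.lt_or_ge (t + 1) w.length with h1 | h1
  · rw [Nat.mod_eq_of_lt h1]
  · rw [show t + 1 = w.length by omega, Nat.mod_self]
    simp [position, h.closed]

/-- The translate by `v` of the cycle in the cube described by a tour. -/
def IsTour.copy (h : IsTour a w) (hL : 3 ≤ w.length) (e : Fin n ≃ ι) (v : ι → ZMod 2) :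
    (SimpleGraph.cycleGraph w.length).Copy (cube n) where
  toHom :=
    { toFun := fun t => toTuple e (v + position w t)
      map_rel' := by
        have key : ∀ s t : Fin w.length, (t : ℕ) = (s + 1) % w.length →
            (cube n).Adj (toTuple e (v + position w s)) (toTuple e (v + position w t)) := by
          intro s t hst
          rw [cube_adj_toTuple, hst, h.position_mod s.2]
          exact ⟨w[s], by rw [add_assoc]; rfl⟩
        intro s t hst
        rcases (cycleGraph_adj_iff hL).1 hst with h1 | h1
        · exact key s t h1
        · exact (key t s h1).symm }
  injective' := by
    intro s t hst
    exact Fin.ext (h.position_injective s.2 t.2 (add_left_cancel (toTuple_injective e hst)))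

theorem IsTour.adj_copy (h : IsTour a w) (hL : 3 ≤ w.length) (e : Fin n ≃ ι)
    (v u : ι → ZMod 2) (i : ι) :
    (h.copy hL e v).toSubgraph.Adj (toTuple e u) (toTuple e (u + unitVec i)) ↔
      ∃ t, ∃ ht : t < w.length, w[t] = i ∧
        (v + position w t = u ∨ v + position w t = u + unitVec i) := by
  have happ : ∀ t, (h.copy hL e v).toHom t = toTuple e (v + position w t) := fun _ => rfl
  simp only [SimpleGraph.Subgraph.map_adj, Relation.map_apply, SimpleGraph.Subgraph.top_adj, happ,
    (toTuple_injective e).eq_iff, cycleGraph_adj_iff hL]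
  have hnext : ∀ s t : Fin w.length, (t : ℕ) = (s + 1) % w.length →
      position w t = position w s + unitVec w[s] := by
    intro s t hst
    rw [hst, h.position_mod s.2]
    rfl
  constructor
  · rintro ⟨s, t, hst | hst, hs, ht⟩
    · rw [hnext s t hst, ← add_assoc, hs] at ht
      exact ⟨s, s.2, unitVec_injective (add_left_cancel ht), .inl hs⟩
    -- The edge is traversed backwards here, from `u + unitVec i` to `u`; in characteristic 2 the
    -- label is still `i`.
    · rw [hnext t s hst, ← add_assoc, ht, add_assoc] at hs
      refine ⟨t, t.2, unitVec_injective ?_, .inr ht⟩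
      have h0 := left_eq_add.1 hs.symm
      rw [add_comm] at h0
      have := add_unitVec_add_unitVec (unitVec w[t]) i
      rwa [h0, zero_add, eq_comm] at this
  · rintro ⟨t, ht, rfl, hu | hu⟩
    · have hlt : (t + 1) % w.length < w.length := Nat.mod_lt _ (by omega)
      refine ⟨⟨t, ht⟩, ⟨_, hlt⟩, .inl rfl, hu, ?_⟩
      simp only [h.position_mod ht, ← hu, add_assoc]
    · have hlt : (t + 1) % w.length < w.length := Nat.mod_lt _ (by omega)
      refine ⟨⟨_, hlt⟩, ⟨t, ht⟩, .inr rfl, ?_, hu⟩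
      simp only [h.position_mod ht, ← add_assoc, hu, add_unitVec_add_unitVec]

theorem IsTour.decomposesInto (h : IsTour a w) (hL : 3 ≤ w.length) (e : Fin n ≃ ι) :
    DecomposesInto (cube n) (SimpleGraph.cycleGraph w.length) := by
  -- The members are the translates by the kernel of `project a`; such translations do not change
  -- the image of an edge in `A`.
  refine ⟨{K | ∃ v, project a v = 0 ∧ K = (h.copy hL e v).toSubgraph}, ?_, ?_⟩
  · intro d hd
    induction d with | _ x y =>
    obtain ⟨u, rfl⟩ := toTuple_surjective e x
    obtain ⟨u', rfl⟩ := toTuple_surjective e y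
    rw [SimpleGraph.mem_edgeSet, cube_adj_toTuple] at hd
    obtain ⟨i, rfl⟩ := hd
    have hself : ∀ z : A, z + z = 0 := fun z => ZModModule.add_self z
    have hcase : ∀ v, project a v = 0 → ∀ t, 
        (v + position w t = u ∨ v + position w t = u + unitVec i) →
        (project a (position w t) = project a u ∧ v + position w t = u ∨
          project a (position w t) = project a u + a i ∧ v + position w t = u + unitVec i) := by
      intro v hv t ht
      refine ht.imp (fun h1 => ⟨?_, h1⟩) (fun h1 => ⟨?_, h1⟩)
      · rw [← h1, map_add, hv, zero_add]
      · rw [← project_unitVec a i, ← map_add, ← h1, map_add, hv, zero_add]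
    obtain ⟨t, ht, hti, hp⟩ := h.exists_step i (project a u)
    have hv : ∃ v, project a v = 0 ∧
        (v + position w t = u ∨ v + position w t = u + unitVec i) := by
      rcases hp with hp | hp
      · exact ⟨u - position w t, by rw [map_sub, hp, sub_self], .inl (by abel)⟩
      · exact ⟨u + unitVec i - position w t,
          by rw [map_sub, map_add, project_unitVec, hp, sub_self], .inr (by abel)⟩
    obtain ⟨v, hv0, hv⟩ := hv
    refine ⟨(h.copy hL e v).toSubgraph, ⟨⟨v, hv0, rfl⟩, ?_⟩, ?_⟩
    · rw [SimpleGraph.Subgraph.mem_edgeSet, h.adj_copy]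
      exact ⟨t, ht, hti, hv⟩
    · rintro K ⟨⟨v', hv0', rfl⟩, hK⟩
      rw [SimpleGraph.Subgraph.mem_edgeSet, h.adj_copy] at hK
      obtain ⟨t', ht', rfl, hv'⟩ := hK
      have hc := hcase v hv0 t hv
      have hc' := hcase v' hv0' t' hv'
      have htt : t = t' := by
        refine h.step_unique ht ht' hti ?_
        rcases hc with ⟨h1, -⟩ | ⟨h1, -⟩ <;> rcases hc' with ⟨h2, -⟩ | ⟨h2, -⟩ <;>
          simp [h1, h2, add_assoc, hself]
      subst htt
      have hne := h.step_ne_zero w[t]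
      -- Both translates meet the edge at the same time `t`. If they met it at opposite ends, the
      -- images of these ends would coincide, forcing the step to be zero.
      have : v' = v := by
        rcases hc with ⟨h1, h3⟩ | ⟨h1, h3⟩ <;> rcases hc' with ⟨h2, h4⟩ | ⟨h2, h4⟩
        · exact add_right_cancel (h4.trans h3.symm)
        · rw [h1, left_eq_add] at h2
          exact absurd h2 hne
        · rw [h2, left_eq_add] at h1
          exact absurd h1 hne
        · exact add_right_cancel (h4.trans h3.symm)
      rw [this]
  · rintro K ⟨v, -, rfl⟩
    exact ⟨(h.copy hL e v).isoToSubgraph.symm⟩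

end Cube


/-! ### Words made of old labels with runs of new labels inserted. -/

section Blocks

variable {ι κ G H : Type*} [AddCommGroup G] [AddCommGroup H]

/-- The steps in a product of two groups, the labels of each kind acting on one factor. -/
def splitStep (g : ι → G) (h : κ → H) : ι ⊕ κ → G × H :=
  Sum.elim (fun i => (g i, 0)) (fun j => (0, h j))

@[simp] theorem splitStep_inl (g : ι → G) (h : κ → H) (i : ι) :
    splitStep g h (.inl i) = (g i, 0) := rfl

@[simp] theorem splitStep_inr (g : ι → G) (h : κ → H) (j : κ) :
    splitStep g h (.inr j) = (0, h j) := rfl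

/-- The word obtained from a list of blocks, each of which is a run of new labels followed by an
old label. -/
def flat (z : List (List κ × ι)) : List (ι ⊕ κ) :=
  z.flatMap fun b => b.1.map Sum.inr ++ [Sum.inl b.2]

@[simp] theorem flat_nil : flat ([] : List (List κ × ι)) = [] := rfl

@[simp] theorem flat_cons (b : List κ × ι) (z : List (List κ × ι)) :
    flat (b :: z) = b.1.map Sum.inr ++ Sum.inl b.2 :: flat z := by
  simp [flat]

/-- The points of a walk, including its end point. -/
def stops (h : κ → H) : H → List κ → List H
  | q, [] => [q]
  | q, j :: R => q :: stops h (q + h j) R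

theorem stops_eq_map (h : κ → H) (q : H) (R : List κ) :
    stops h q R = (stops h 0 R).map (q + ·) := by
  have key : ∀ (p q : H) (R : List κ), stops h (q + p) R = (stops h p R).map (q + ·) := by
    intro p q R
    induction R generalizing p with
    | nil => rfl
    | cons j R ih => simp [stops, add_assoc, ih]
  simpa using key 0 q R

theorem sum_map_inr (g : ι → G) (h : κ → H) (R : List κ) :
    ((R.map Sum.inr).map (splitStep g h)).sum = (0, (R.map h).sum) := by
  induction R with
  | nil => rfl
  | cons j R ih => simp only [List.map_cons, List.sum_cons, ih]; simp

theorem sum_flat (g : ι → G) (h : κ → H) (z : List (List κ × ι)) :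
    ((flat z).map (splitStep g h)).sum =
      (((z.map Prod.snd).map g).sum, (z.map fun b => (b.1.map h).sum).sum) := by
  induction z with
  | nil => rfl
  | cons b z ih =>
    rw [flat_cons, List.map_append, List.sum_append, sum_map_inr, List.map_cons, List.sum_cons, ih]
    simp

theorem points_block (g : ι → G) (h : κ → H) (x : G) (q : H) (R : List κ) (i : ι)
    (l : List (ι ⊕ κ)) :
    points (splitStep g h) (x, q) (R.map Sum.inr ++ Sum.inl i :: l) =
      (stops h q R).map (Prod.mk x) ++
        points (splitStep g h) (x + g i, q + (R.map h).sum) l := by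
  induction R generalizing q with
  | nil => simp [stops]
  | cons j R ih => simp [stops, ih, add_assoc]

theorem fst_mem_of_mem_points_flat (g : ι → G) (h : κ → H) {x : G} {q : H}
    {z : List (List κ × ι)} {v : G × H} (hv : v ∈ points (splitStep g h) (x, q) (flat z)) :
    v.1 ∈ points g x (z.map Prod.snd) := by
  induction z generalizing x q with
  | nil => simp at hv
  | cons b z ih =>
    rw [flat_cons, points_block, List.mem_append, List.mem_map] at hv
    rcases hv with ⟨p, -, rfl⟩ | hv
    · simp
    · simp [ih hv]

/-- Old coordinates separate different blocks, because the old walk is simple; new coordinates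
separate the points inside one block. -/
theorem nodup_points_flat (g : ι → G) (h : κ → H) {x : G} {q : H} {z : List (List κ × ι)}
    (hz : (points g x (z.map Prod.snd)).Nodup) (hr : ∀ b ∈ z, ∀ p, (stops h p b.1).Nodup) :
    (points (splitStep g h) (x, q) (flat z)).Nodup := by
  induction z generalizing x q with
  | nil => simp
  | cons b z ih =>
    simp only [List.map_cons, points_cons, List.nodup_cons] at hz
    rw [flat_cons, points_block, List.nodup_append']
    refine ⟨(hr b (by simp) q).map fun _ _ h => (Prod.mk.inj h).2,
      ih hz.2 fun c hc => hr c (by simp [hc]), ?_⟩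
    intro v hv hv'
    obtain ⟨p, -, rfl⟩ := List.mem_map.1 hv
    exact hz.1 (fst_mem_of_mem_points_flat g h hv')

end Blocks

section UnitVec

variable {ι κ : Type*} [DecidableEq ι] [DecidableEq κ]

theorem apply_of_mem_stops {q v : κ → ZMod 2} {R : List κ} (hv : v ∈ stops unitVec q R) {j : κ}
    (hj : j ∉ R) : v j = q j := by
  induction R generalizing q with
  | nil => simp_all [stops]
  | cons r R ih =>
    simp only [List.mem_cons, not_or] at hj
    simp only [stops, List.mem_cons] at hv
    rcases hv with rfl | hv
    · rfl
    · rw [ih hv hj.2]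
      simp [unitVec, hj.1]

theorem nodup_stops {R : List κ} (hR : R.Nodup) (q : κ → ZMod 2) :
    (stops unitVec q R).Nodup := by
  induction R generalizing q with
  | nil => simp [stops]
  | cons r R ih =>
    rw [List.nodup_cons] at hR
    rw [stops, List.nodup_cons]
    refine ⟨fun hc => ?_, ih hR.2 _⟩
    have := apply_of_mem_stops hc hR.1
    simp [unitVec] at this

theorem sum_unitVec_apply (R : List κ) (j : κ) :
    (R.map unitVec).sum j = (R.count j : ZMod 2) := by
  induction R with
  | nil => simp
  | cons r R ih =>
    simp only [List.map_cons, List.sum_cons, Pi.add_apply, ih, List.count_cons]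
    by_cases h : r = j
    · subst h
      simp [unitVec, add_comm]
    · simp [unitVec, h, Ne.symm h]

/-- The splitting of vectors into their two families of coordinates. -/
def splitVec : (ι ⊕ κ → ZMod 2) →+ (ι → ZMod 2) × (κ → ZMod 2) where
  toFun v := (v ∘ Sum.inl, v ∘ Sum.inr)
  map_zero' := rfl
  map_add' _ _ := rfl

theorem splitVec_injective : Function.Injective (splitVec : (ι ⊕ κ → ZMod 2) →+ _) := by
  intro u v h
  funext k
  cases k with
  | inl i => exact congrFun (Prod.mk.inj h).1 i
  | inr j => exact congrFun (Prod.mk.inj h).2 j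

theorem splitVec_unitVec (k : ι ⊕ κ) : splitVec (unitVec k) = splitStep unitVec unitVec k := by
  cases k with
  | inl i =>
    refine Prod.ext (funext fun k => ?_) (funext fun k => ?_) <;>
      simp [splitVec, unitVec, Pi.single_apply]
  | inr j =>
    refine Prod.ext (funext fun k => ?_) (funext fun k => ?_) <;>
      simp [splitVec, unitVec, Pi.single_apply]

theorem closed_of_split {l : List (ι ⊕ κ)}
    (h : (l.map (splitStep (unitVec (ι := ι)) (unitVec (ι := κ)))).sum = 0) :
    (l.map unitVec).sum = 0 := by
  apply splitVec_injective
  rw [map_list_sum, List.map_map, map_zero, ← h]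
  congr 2
  funext k
  exact splitVec_unitVec k

theorem simple_of_split {l : List (ι ⊕ κ)}
    (h : (points (splitStep (unitVec (ι := ι)) (unitVec (ι := κ))) 0 l).Nodup) :
    (points unitVec 0 l).Nodup := by
  refine List.Nodup.of_map splitVec ?_
  rw [map_points, map_zero]
  simpa only [splitVec_unitVec] using h

end UnitVec

/-! ### Two more labels over the same group. -/

section AddPair

variable {ι A : Type*} [DecidableEq ι] [AddCommGroup A] [Module (ZMod 2) A] [DecidableEq A]

/-- The blocks that put two new labels in front of every occurrence of `j`. -/
def pairBlocks (j : ι) (l : List ι) : List (List Bool × ι) :=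
  l.map fun i => (if i = j then [false, true] else [], i)

/-- Each step `j` from `x` becomes `x → x + a j → x → x + a j`. So `false` repeats the arc of `j`
and `true` runs through the same edge in reverse. -/
theorem tally_arcs_pairBlocks (a : ι → A) (j : ι) (x : A) (l : List ι) (y : A) :
    (∀ i, tally (Sum.inl i) y (arcs (Sum.elim a fun _ => a j) x (flat (pairBlocks j l))) =
      tally i y (arcs a x l)) ∧
    tally (Sum.inr false) y (arcs (Sum.elim a fun _ => a j) x (flat (pairBlocks j l))) =
      tally j y (arcs a x l) ∧
    tally (Sum.inr true) y (arcs (Sum.elim a fun _ => a j) x (flat (pairBlocks j l))) =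
      tally j (y + a j) (arcs a x l) := by
  have hself : a j + a j = 0 := ZModModule.add_self _
  induction l generalizing x with
  | nil => simp [pairBlocks]
  | cons i l ih =>
    obtain ⟨h1, h2, h3⟩ := ih (x + a i)
    rw [pairBlocks] at h1 h2 h3
    by_cases hi : i = j
    · subst hi
      have hx : x = y + a i ↔ x + a i = y := by
        constructor
        · rintro rfl
          rw [add_assoc, hself, add_zero]
        · rintro rfl
          rw [add_assoc, hself, add_zero]
      simp [pairBlocks, h1, h2, h3, add_assoc, hself, hx]
    · simp [pairBlocks, h1, h2, h3, hi]

/-- The scalar is the parity of the number of occurrences of `j`, which vanishes for a closed word.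
-/
theorem sum_pairBlocks (j : ι) (l : List ι) :
    ((pairBlocks j l).map fun b => (b.1.map (unitVec (ι := Bool))).sum).sum =
      (l.map unitVec).sum j • (unitVec false + unitVec true) := by
  induction l with
  | nil => simp [pairBlocks]
  | cons i l ih =>
    have hj : (unitVec i : ι → ZMod 2) j = if i = j then 1 else 0 := by
      simp [unitVec, Pi.single_apply, eq_comm]
    change ((if i = j then [false, true] else []).map unitVec).sum +
      ((pairBlocks j l).map fun b => (b.1.map (unitVec (ι := Bool))).sum).sum = _
    rw [ih, List.map_cons, List.sum_cons, Pi.add_apply, hj, add_smul]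
    split_ifs <;> simp

theorem map_snd_pairBlocks (j : ι) (l : List ι) : (pairBlocks j l).map Prod.snd = l := by
  simp [pairBlocks, Function.comp_def]

theorem IsTour.addPair {a : ι → A} {w : List ι} (h : IsTour a w) (j : ι) :
    IsTour (Sum.elim a fun _ : Bool => a j) (flat (pairBlocks j w)) where
  step_ne_zero k := by cases k <;> simp [h.step_ne_zero]
  tally_arcs k y := by
    have hself : a j + a j = 0 := ZModModule.add_self _
    have h1 := tally_arcs_pairBlocks a j 0 w y
    have h2 := fun i => tally_arcs_pairBlocks a j 0 w (y + a i)
    rcases k with i | _ | _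
    · rw [h1.1, Sum.elim_inl, (h2 i).1, h.tally_arcs]
    · rw [h1.2.1, Sum.elim_inr, (h2 j).2.1, h.tally_arcs]
    · rw [h1.2.2, Sum.elim_inr, (h2 j).2.2, add_assoc, hself, add_zero, add_comm, h.tally_arcs]
  closed := by
    apply closed_of_split
    rw [sum_flat, sum_pairBlocks, map_snd_pairBlocks, h.closed]
    simp
  simple := by
    apply simple_of_split
    refine nodup_points_flat _ _ (by rw [map_snd_pairBlocks]; exact h.simple) ?_
    intro b hb p
    apply nodup_stops
    obtain ⟨i, -, rfl⟩ := List.mem_map.1 hb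
    dsimp only
    split_ifs <;> simp

end AddPair

/-! ### Doubling: the ingredients, with `A × ZMod 2` as two layers joined by rungs. -/

section Double

variable {ι κ A : Type*} [DecidableEq ι] [DecidableEq κ] [AddCommGroup A] [DecidableEq A]

/-- The blocks that put the run `R` in front of the first letter of `l` at which the walk from `x`
is in `y`, for every `y` in `T`. -/
def decorate (a : ι → A) (R : List κ) : A → Finset A → List ι → List (List κ × ι)
  | _, _, [] => []
  | x, T, i :: l => (if x ∈ T then R else [], i) :: decorate a R (x + a i) (T.erase x) l

@[simp] theorem map_snd_decorate (a : ι → A) (R : List κ) (x : A) (T : Finset A) (l : List ι) :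
    (decorate a R x T l).map Prod.snd = l := by
  induction l generalizing x T with
  | nil => rfl
  | cons i l ih => simp [decorate, ih]

theorem fst_eq_of_mem_decorate {a : ι → A} {R : List κ} {x : A} {T : Finset A} {l : List ι}
    {b : List κ × ι} (hb : b ∈ decorate a R x T l) : b.1 = R ∨ b.1 = [] := by
  induction l generalizing x T with
  | nil => simp [decorate] at hb
  | cons i l ih =>
    rw [decorate, List.mem_cons] at hb
    rcases hb with rfl | hb
    · dsimp only
      split_ifs <;> simp
    · exact ih hb

theorem sum_decorate {H : Type*} [AddCommGroup H] (h : κ → H) (a : ι → A) (R : List κ) (x : A)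
    (T : Finset A) (l : List ι) (hT : ∀ y ∈ T, y ∈ points a x l) :
    ((decorate a R x T l).map fun b => (b.1.map h).sum).sum = T.card • (R.map h).sum := by
  induction l generalizing x T with
  | nil =>
    have : T = ∅ := Finset.eq_empty_of_forall_notMem fun y hy => by simpa using hT y hy
    simp [decorate, this]
  | cons i l ih =>
    have hT' : ∀ y ∈ T.erase x, y ∈ points a (x + a i) l := by
      intro y hy
      rw [Finset.mem_erase] at hy
      simpa [hy.1] using hT y hy.2
    rw [decorate, List.map_cons, List.sum_cons, ih _ _ hT']
    by_cases hx : x ∈ T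
    · rw [if_pos hx, ← Finset.card_erase_add_one hx, succ_nsmul, add_comm]
    · rw [if_neg hx, Finset.erase_eq_of_notMem hx]
      simp

/-- The number of passes, in a list of arcs, through the edge with label `j` above `y`. -/
def rungs (j : κ) (y : A) (L : List ((ι ⊕ κ) × (A × ZMod 2))) : ℕ :=
  tally (Sum.inr j) (y, 0) L + tally (Sum.inr j) (y, 1) L

@[simp] theorem rungs_nil (j : κ) (y : A) :
    rungs j y ([] : List ((ι ⊕ κ) × (A × ZMod 2))) = 0 := rfl

theorem rungs_append (j : κ) (y : A) (L L' : List ((ι ⊕ κ) × (A × ZMod 2))) :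
    rungs j y (L ++ L') = rungs j y L + rungs j y L' := by
  simp only [rungs, tally_append]
  omega

@[simp] theorem rungs_inl_cons (j : κ) (y : A) (i : ι) (p : A × ZMod 2)
    (L : List ((ι ⊕ κ) × (A × ZMod 2))) :
    rungs j y ((Sum.inl i, p) :: L) = rungs j y L := by
  simp [rungs]

/-- A run of new labels goes back and forth above `x`, so each letter passes one rung there; the
direction, which depends on the layer, does not matter. -/
theorem rungs_run (a : ι → A) (j : κ) (x y : A) (e : ZMod 2) (R : List κ) :
    rungs j y (arcs (splitStep a fun _ : κ => (1 : ZMod 2)) (x, e) (R.map Sum.inr)) =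
      if y = x then R.count j else 0 := by
  induction R generalizing e with
  | nil => simp
  | cons k R ih =>
    have h := ih (e + 1)
    rw [rungs] at h ⊢
    simp only [List.map_cons, arcs_cons, splitStep_inr, Prod.mk_add_mk, add_zero, tally_cons,
      Prod.mk.injEq, Sum.inr.injEq, eq_comm (a := x), List.count_cons, beq_iff_eq]
    have he : ∀ e : ZMod 2, e = 0 ∨ e = 1 := by decide
    replace he := he e
    by_cases hy : y = x <;> by_cases hk : k = j <;> rcases he with rfl | rfl <;>
      simp only [hy, hk, if_true, if_false, and_true, and_false,
        one_ne_zero, zero_ne_one] at h ⊢ <;> omega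

theorem tally_inl_run (a : ι → A) (i : ι) (p p' : A × ZMod 2) (R : List κ) :
    tally (Sum.inl i) p' (arcs (splitStep a fun _ : κ => (1 : ZMod 2)) p (R.map Sum.inr)) = 0 := by
  induction R generalizing p with
  | nil => rfl
  | cons k R ih => simp [ih]

theorem arcs_block (a : ι → A) (x : A) (e : ZMod 2) (R : List κ) (i : ι) (l : List (ι ⊕ κ)) :
    arcs (splitStep a fun _ : κ => (1 : ZMod 2)) (x, e) (R.map Sum.inr ++ Sum.inl i :: l) =
      arcs (splitStep a fun _ : κ => (1 : ZMod 2)) (x, e) (R.map Sum.inr) ++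
        (Sum.inl i, (x, e + R.length)) ::
          arcs (splitStep a fun _ : κ => (1 : ZMod 2)) (x + a i, e + R.length) l := by
  rw [arcs_append, sum_map_inr]
  simp

/-- Runs of even length return to their layer, so every old step is made in the layer `e`. -/
theorem tally_inl_flat (a : ι → A) (i : ι) (x y : A) (e e' : ZMod 2) (z : List (List κ × ι))
    (hz : ∀ b ∈ z, Even b.1.length) :
    tally (Sum.inl i) (y, e') (arcs (splitStep a fun _ : κ => (1 : ZMod 2)) (x, e) (flat z)) =
      if e = e' then tally i y (arcs a x (z.map Prod.snd)) else 0 := by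
  induction z generalizing x with
  | nil => simp
  | cons b z ih =>
    have hb : (b.1.length : ZMod 2) = 0 :=
      (ZMod.natCast_eq_zero_iff_even).2 (hz b (by simp))
    rw [flat_cons, arcs_block, tally_append, tally_inl_run, tally_cons, hb, add_zero,
      ih _ fun c hc => hz c (by simp [hc])]
    by_cases he : e = e' <;> simp [he]

theorem rungs_decorate (a : ι → A) (R : List κ) (j : κ) (x y : A) (e : ZMod 2) (T : Finset A)
    (l : List ι) (hT : ∀ y ∈ T, y ∈ points a x l) :
    rungs j y (arcs (splitStep a fun _ : κ => (1 : ZMod 2)) (x, e) (flat (decorate a R x T l))) =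
      if y ∈ T then R.count j else 0 := by
  induction l generalizing x e T with
  | nil =>
    have : T = ∅ := Finset.eq_empty_of_forall_notMem fun y hy => by simpa using hT y hy
    simp [decorate, this]
  | cons i l ih =>
    have hT' : ∀ y ∈ T.erase x, y ∈ points a (x + a i) l := by
      intro y hy
      rw [Finset.mem_erase] at hy
      simpa [hy.1] using hT y hy.2
    rw [decorate, flat_cons, arcs_block, rungs_append, rungs_run, rungs_inl_cons, ih _ _ _ hT']
    by_cases hx : x ∈ T
    · by_cases hy : y = x
      · simp [hy, hx]
      · simp [hy]
    · rw [Finset.erase_eq_of_notMem hx]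
      simp [hx]

/-- The new coordinates record `c` completed runs and a partial run `p`. -/
theorem snd_of_mem_points_decorate {G : Type*} [AddCommGroup G] {g : ι → G}
    {a : ι → A} {R : List κ} {x : A} {T : Finset A} {l : List ι} {u : G} {q : κ → ZMod 2}
    {v : G × (κ → ZMod 2)}
    (hv : v ∈ points (splitStep g unitVec) (u, q) (flat (decorate a R x T l))) :
    ∃ c : ℕ, ∃ p ∈ stops unitVec 0 R, v.2 = q + c • (R.map unitVec).sum + p := by
  have h0 : (0 : κ → ZMod 2) ∈ stops unitVec 0 R := by cases R <;> simp [stops]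
  induction l generalizing x T u q with
  | nil => simp [decorate] at hv
  | cons i l ih =>
    rw [decorate, flat_cons, points_block, List.mem_append, List.mem_map] at hv
    rcases hv with ⟨p, hp, rfl⟩ | hv
    · refine ⟨0, ?_⟩
      dsimp only at hp
      split_ifs at hp
      · rw [stops_eq_map, List.mem_map] at hp
        obtain ⟨p, hp, rfl⟩ := hp
        exact ⟨p, hp, by simp⟩
      · refine ⟨0, h0, ?_⟩
        simpa [stops] using hp
    · obtain ⟨c, p, hp, e⟩ := ih hv
      dsimp only at e
      split_ifs at e
      · exact ⟨c + 1, p, hp, by rw [e, succ_nsmul']; abel⟩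
      · exact ⟨c, p, hp, by rw [e]; simp⟩

end Double


/-! ### Doubling: the two halves of the new tour. -/

section Double

variable {ι κ A : Type*} [DecidableEq ι] [DecidableEq κ] [AddCommGroup A] [DecidableEq A]

theorem flat_append (z z' : List (List κ × ι)) : flat (z ++ z') = flat z ++ flat z' := by
  simp [flat]

theorem add_mem_points_of_mem_arcs {a : ι → A} {x z : A} {i : ι} {l : List ι}
    (h : (i, x) ∈ arcs a z l) : x + a i ∈ points a z l ∨ x + a i = z + (l.map a).sum := by
  induction l generalizing z with
  | nil => simp at h
  | cons j l ih =>
    rw [arcs_cons, List.mem_cons, Prod.mk.injEq] at h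
    rcases h with ⟨rfl, rfl⟩ | h
    · cases l <;> simp
    · rcases ih h with h1 | h1
      · exact .inl (by simp [h1])
      · exact .inr (by simp [h1, add_assoc])

theorem sum_unitVec_of_nodup {R : List κ} (hR : R.Nodup) (j : κ) :
    (R.map unitVec).sum j = if j ∈ R then 1 else 0 := by
  rw [sum_unitVec_apply]
  split_ifs with h
  · simp [List.count_eq_one_of_mem hR h]
  · simp [List.count_eq_zero_of_not_mem h]

variable [Module (ZMod 2) A] [Fintype A]

/-- The tour passes the edge labelled `i` at `y`, so it leaves `y` or arrives there; an arrival at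
the very end is at 0, the starting point. -/
theorem IsTour.mem_points [Fintype ι] {a : ι → A} {i : ι} {l : List ι} (h : IsTour a (i :: l))
    (y : A) : y ∈ points a 0 (i :: l) := by
  have hc := h.tally_arcs i y
  by_cases h0 : tally i y (arcs a 0 (i :: l)) = 0
  · have h1 := add_mem_points_of_mem_arcs (tally_pos_iff.1 (by omega) :
      (i, y + a i) ∈ arcs a 0 (i :: l))
    rw [h.sum_eq_zero, add_assoc, ZModModule.add_self, add_zero, add_zero] at h1
    rcases h1 with h1 | rfl
    · exact h1
    · simp
  · exact List.mem_map.2 ⟨_, tally_pos_iff.1 (Nat.pos_of_ne_zero h0), rfl⟩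

/-- The first half of the doubled word. -/
def lowerBlocks (a : ι → A) (i₀ i₁ : ι) (l : List ι) (r₁ r₂ r₃ : κ) (rs : List κ) :
    List (List κ × ι) :=
  (r₂ :: r₃ :: rs, i₀) :: ([r₁, r₂], i₁) ::
    decorate a (r₁ :: r₂ :: r₃ :: rs) (a i₀ + a i₁) {0, a i₀}ᶜ l

/-- The second half of the doubled word. -/
def upperBlocks (a : ι → A) (i₀ i₁ : ι) (l : List ι) (r₁ r₃ : κ) (rs : List κ) :
    List (List κ × ι) :=
  ([r₁], i₀) :: (r₃ :: rs, i₁) :: decorate a [] (a i₀ + a i₁) ∅ l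

/-- As the old walk is simple, two points of different halves can agree only if they belong to the
same letter of the old word. Three cases remain: the first letter, the second, and the tail. In
each, the coordinates `r₁`, `r₂`, `r₃` tell the halves apart. -/
theorem disjoint_halves {a : ι → A} {i₀ i₁ : ι} {l : List ι} {r₁ r₂ r₃ : κ} {rs : List κ}
    (hs : (points unitVec 0 (i₀ :: i₁ :: l)).Nodup) (hR : (r₁ :: r₂ :: r₃ :: rs).Nodup) :
    List.Disjoint
      (points (splitStep unitVec unitVec) (0, 0) (flat (lowerBlocks a i₀ i₁ l r₁ r₂ r₃ rs)))
      (points (splitStep unitVec unitVec)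
        (0, ((r₂ :: r₃ :: rs).map unitVec).sum + ([r₁, r₂].map unitVec).sum)
        (flat (upperBlocks a i₀ i₁ l r₁ r₃ rs))) := by
  simp only [points_cons, zero_add, List.nodup_cons, List.mem_cons, not_or] at hs
  obtain ⟨⟨h01, h02⟩, h12, -⟩ := hs
  have hD : (r₂ :: r₃ :: rs).Nodup := hR.of_cons
  have hR3 : (r₃ :: rs).Nodup := hD.of_cons
  have sD := sum_unitVec_of_nodup hD
  have sR := sum_unitVec_of_nodup hR
  have sR3 := sum_unitVec_of_nodup hR3
  have e12 : r₁ ≠ r₂ := by rintro rfl; simp at hR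
  have e13 : r₁ ≠ r₃ := by rintro rfl; simp at hR
  have e23 : r₂ ≠ r₃ := by rintro rfl; simp at hR
  have m1 : r₁ ∉ rs := by intro h; simp [h] at hR
  have m2 : r₂ ∉ rs := by intro h; simp [h] at hR
  have u : ∀ i j : κ, (unitVec i : κ → ZMod 2) j = if j = i then 1 else 0 := by
    intro i j
    simp [unitVec, Pi.single_apply]
  have two : (1 : ZMod 2) + 1 = 0 := by decide
  have s2 : ([r₁, r₂].map (unitVec (ι := κ))).sum = unitVec r₁ + unitVec r₂ := by simp
  have s1 : ([r₁].map (unitVec (ι := κ))).sum = unitVec r₁ := by simp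
  rw [s2]
  generalize hd : ((r₂ :: r₃ :: rs).map (unitVec (ι := κ))).sum = d at *
  generalize ht : ((r₃ :: rs).map (unitVec (ι := κ))).sum = t at *
  have d1 : d r₁ = 0 := by simp [sD, e12, e13, m1]
  have d2 : d r₂ = 1 := by simp [sD]
  have d3 : d r₃ = 1 := by simp [sD]
  have t1 : t r₁ = 0 := by simp [sR3, e13, m1]
  have t2 : t r₂ = 0 := by simp [sR3, e23, m2]
  have t3 : t r₃ = 1 := by simp [sR3]
  intro v hv hv'
  rw [lowerBlocks, flat_cons, points_block, flat_cons, points_block, List.mem_append,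
    List.mem_append, List.mem_map, List.mem_map, zero_add, zero_add, hd, s2] at hv
  rw [upperBlocks, flat_cons, points_block, flat_cons, points_block, List.mem_append,
    List.mem_append, List.mem_map, List.mem_map, zero_add, s1, ht] at hv'
  rcases hv with ⟨p, hp, rfl⟩ | ⟨p, hp, rfl⟩ | hv <;>
    rcases hv' with ⟨p', hp', e⟩ | ⟨p', hp', e⟩ | hv'
  · obtain rfl := (Prod.mk.inj e).2
    have p1 : p' r₁ = 0 := by
      rw [apply_of_mem_stops hp (by simp [e12, e13, m1])]
      rfl
    simp only [stops, List.mem_cons, List.not_mem_nil, or_false] at hp'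
    rcases hp' with rfl | rfl
    · simp [u, d1, e12] at p1
    · rw [stops, List.mem_cons] at hp
      rcases hp with hp | hp
      · have := congrFun hp r₃
        simp [u, d3, e13.symm, e23.symm] at this
      · have := apply_of_mem_stops hp (j := r₂) (by simp [e23, m2])
        simp [u, d2, e12.symm, two] at this
  · exact absurd (Prod.mk.inj e).1.symm h01
  · have := fst_mem_of_mem_points_flat _ _ hv'
    rw [map_snd_decorate] at this
    exact absurd this h02
  · exact absurd (Prod.mk.inj e).1 h01
  · obtain rfl := (Prod.mk.inj e).2
    have p1 := apply_of_mem_stops hp' (j := r₁) (by simp [e13, m1])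
    have p2 := apply_of_mem_stops hp' (j := r₂) (by simp [e23, m2])
    simp only [stops, List.mem_cons, List.not_mem_nil, or_false] at hp
    rcases hp with rfl | rfl | rfl <;>
      simp [u, d1, d2, e12, e12.symm, two] at p1 p2
  · have := fst_mem_of_mem_points_flat _ _ hv'
    rw [map_snd_decorate] at this
    exact absurd this h12
  · have := fst_mem_of_mem_points_flat _ _ hv
    rw [map_snd_decorate, ← e] at this
    exact absurd this h02
  · have := fst_mem_of_mem_points_flat _ _ hv
    rw [map_snd_decorate, ← e] at this
    exact absurd this h12
  -- In the tail, the upper half has no runs and its new coordinates are constant. The lower half is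
  -- compared with it according to whether the partial run is empty, is `r₁` alone, or contains both
  -- `r₁` and `r₂`.
  · obtain ⟨c, p, hp, e⟩ := snd_of_mem_points_decorate hv
    obtain ⟨c', p', hp', e'⟩ := snd_of_mem_points_decorate hv'
    simp only [stops, List.mem_singleton] at hp'
    subst hp'
    rw [e] at e'
    have c1 := congrFun e' r₁
    have c2 := congrFun e' r₂
    have c3 := congrFun e' r₃
    simp only [Pi.add_apply, Pi.smul_apply, u, d1, d2, d3, t1, t2, t3, sR, e12, e12.symm,
      e13.symm, e23.symm, List.mem_cons, List.map_nil, List.sum_nil, Pi.zero_apply, true_or,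
      or_true, if_true, if_false, smul_zero, add_zero] at c1 c2 c3
    simp only [nsmul_eq_mul, mul_one] at c1 c2 c3
    generalize (c : ZMod 2) = k at c1 c2 c3
    rw [stops, List.mem_cons, stops, List.mem_cons] at hp
    rcases hp with rfl | rfl | hp
    · simp only [Pi.zero_apply] at c1 c2 c3
      have key : ∀ k : ZMod 2, 0 + 1 + k + 0 = 0 + 1 + 1 →
          1 + (0 + 1) + k + 0 = 1 + (0 + 1) → False := by decide
      exact key k c1 c2
    · simp only [Pi.add_apply, Pi.zero_apply, u, e12.symm, e13.symm, if_true, if_false] at c1 c2 c3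
      have key : ∀ k : ZMod 2, 0 + 1 + k + (0 + 1) = 0 + 1 + 1 →
          1 + k + (0 + 0) = 1 + 1 → False := by decide
      exact key k c1 c3
    · have p1 := apply_of_mem_stops hp (j := r₁) (by simp [e13, m1])
      have p2 := apply_of_mem_stops hp (j := r₂) (by simp [e23, m2])
      simp only [Pi.add_apply, Pi.zero_apply, u, e12, e12.symm, if_true, if_false] at p1 p2
      rw [p1] at c1
      rw [p2] at c2
      have key : ∀ k : ZMod 2, 0 + 1 + k + (0 + 1 + 0) = 0 + 1 + 1 →
          1 + (0 + 1) + k + (0 + 0 + 1) = 1 + (0 + 1) → False := by decide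
      exact key k c1 c2

variable [Fintype ι] {a : ι → A} {i₀ i₁ : ι} {l : List ι} {r₁ r₂ r₃ : κ} {rs : List κ}

theorem IsTour.mem_points_tail (h : IsTour a (i₀ :: i₁ :: l)) {y : A}
    (hy : y ∈ ({0, a i₀}ᶜ : Finset A)) : y ∈ points a (a i₀ + a i₁) l := by
  have h1 := h.mem_points y
  simp only [Finset.mem_compl, Finset.mem_insert, Finset.mem_singleton, not_or] at hy
  simpa [hy.1, hy.2] using h1

theorem sum_lowerBlocks {H : Type*} [AddCommGroup H] [Module (ZMod 2) H] (f : κ → H)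
    (hT : ∀ y ∈ ({0, a i₀}ᶜ : Finset A), y ∈ points a (a i₀ + a i₁) l)
    (hcard : Even ({0, a i₀}ᶜ : Finset A).card) :
    ((lowerBlocks a i₀ i₁ l r₁ r₂ r₃ rs).map fun b => (b.1.map f).sum).sum =
      ((r₂ :: r₃ :: rs).map f).sum + ([r₁, r₂].map f).sum := by
  have h := sum_decorate f a (r₁ :: r₂ :: r₃ :: rs) _ _ l hT
  obtain ⟨k, hk⟩ := hcard
  rw [hk, add_nsmul, ZModModule.add_self] at h
  simp only [lowerBlocks, List.map_cons, List.sum_cons] at h ⊢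
  rw [h, add_zero]

theorem sum_upperBlocks {H : Type*} [AddCommGroup H] (f : κ → H) :
    ((upperBlocks a i₀ i₁ l r₁ r₃ rs).map fun b => (b.1.map f).sum).sum =
      ([r₁].map f).sum + ((r₃ :: rs).map f).sum := by
  have h := sum_decorate f a ([] : List κ) (a i₀ + a i₁) ∅ l (by simp)
  rw [Finset.card_empty, zero_nsmul] at h
  simp only [upperBlocks, List.map_cons, List.sum_cons] at h ⊢
  rw [h, add_zero]

/-- The old word is traversed twice. The first run of each half has odd length, so the first half
makes its old steps in layer 1 and the second in layer 0; all other runs are even. Above each `y`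
other than 0 and `a i₀`, the first half inserts one run of all new labels. Above these two points
the labels are shared between the halves, which keeps the halves disjoint and lets them change
layers. -/
theorem IsTour.double (h : IsTour a (i₀ :: i₁ :: l)) (hA : Even (Fintype.card A))
    (hR : (r₁ :: r₂ :: r₃ :: rs).Nodup) (hall : ∀ j, j ∈ r₁ :: r₂ :: r₃ :: rs)
    (hodd : Odd rs.length) :
    IsTour (splitStep a fun _ : κ => (1 : ZMod 2))
      (flat (lowerBlocks a i₀ i₁ l r₁ r₂ r₃ rs ++ upperBlocks a i₀ i₁ l r₁ r₃ rs)) := by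
  have hT := fun y (hy : y ∈ ({0, a i₀}ᶜ : Finset A)) => h.mem_points_tail hy
  have hne := h.step_ne_zero i₀
  have hcard : Even ({0, a i₀}ᶜ : Finset A).card := by
    rw [Finset.card_compl, Finset.card_pair hne.symm]
    obtain ⟨k, hk⟩ := hA
    exact ⟨k - 1, by omega⟩
  have hrs : (rs.length : ZMod 2) = 1 := (ZMod.natCast_eq_one_iff_odd).2 hodd
  have two : (1 : ZMod 2) + 1 = 0 := by decide
  have wlow : (lowerBlocks a i₀ i₁ l r₁ r₂ r₃ rs).map Prod.snd = i₀ :: i₁ :: l := by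
    simp [lowerBlocks]
  have wup : (upperBlocks a i₀ i₁ l r₁ r₃ rs).map Prod.snd = i₀ :: i₁ :: l := by
    simp [upperBlocks]
  constructor
  · rintro (i | j) <;> simp [h.step_ne_zero]
  · have hstart : ((flat (lowerBlocks a i₀ i₁ l r₁ r₂ r₃ rs)).map
        (splitStep a fun _ : κ => (1 : ZMod 2))).sum = (0, 1) := by
      rw [sum_flat, sum_lowerBlocks _ hT hcard, wlow, h.sum_eq_zero]
      simp [hrs, two]
    rintro (i | j) ⟨y, e⟩
    · have htot : ∀ y e, tally (Sum.inl i) (y, e) (arcs (splitStep a fun _ : κ => (1 : ZMod 2)) 0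
          (flat (lowerBlocks a i₀ i₁ l r₁ r₂ r₃ rs ++ upperBlocks a i₀ i₁ l r₁ r₃ rs))) =
          tally i y (arcs a 0 (i₀ :: i₁ :: l)) := by
        -- Only the leading run `R` of a half can change the layer, and it precedes every old step.
        have hskip : ∀ (y : A) (e e' : ZMod 2) (R : List κ) (z : List (List κ × ι)),
            (∀ b ∈ z, Even b.1.length) →
            tally (Sum.inl i) (y, e) (arcs (splitStep a fun _ : κ => (1 : ZMod 2)) (0, e')
              (flat ((R, i₀) :: z))) =
            if e' + R.length = e then tally i y (arcs a 0 (i₀ :: z.map Prod.snd)) else 0 := by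
          intro y e e' R z hz
          rw [flat_cons, arcs_block, tally_append, tally_inl_run, tally_cons,
            tally_inl_flat _ _ _ _ _ _ _ hz, arcs_cons, tally_cons]
          by_cases he : e' + R.length = e <;> simp [he]
        intro y e
        rw [flat_append, arcs_append, hstart, tally_append, zero_add]
        have hz : (0 : A × ZMod 2) = (0, 0) := rfl
        rw [hz, lowerBlocks, upperBlocks, hskip, hskip]
        · have he : ∀ e : ZMod 2, e = 0 ∨ e = 1 := by decide
          have hlen : ((r₂ :: r₃ :: rs).length : ZMod 2) = 1 :=
            ZMod.natCast_eq_one_iff_odd.2 (by simpa [add_assoc] using hodd.add_even even_two)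
          rw [hlen]
          rcases he e with rfl | rfl <;> simp [two]
        · intro b hb
          rw [List.mem_cons] at hb
          rcases hb with rfl | hb
          · exact hodd.add_one
          · rcases fst_eq_of_mem_decorate hb with h1 | h1 <;> simp [h1]
        · intro b hb
          rw [List.mem_cons] at hb
          rcases hb with rfl | hb
          · simp
          · rcases fst_eq_of_mem_decorate hb with h1 | h1
            · rw [h1]
              simpa [add_assoc] using hodd.add_odd (by decide : Odd 3)
            · simp [h1]
      rw [splitStep_inl, Prod.mk_add_mk, add_zero, htot, htot, h.tally_arcs]
    · have hrung : rungs j y (arcs (splitStep a fun _ : κ => (1 : ZMod 2)) 0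
          (flat (lowerBlocks a i₀ i₁ l r₁ r₂ r₃ rs ++ upperBlocks a i₀ i₁ l r₁ r₃ rs))) = 1 := by
        have hc := List.count_eq_one_of_mem hR (hall j)
        have hz : (0 : A × ZMod 2) = (0, 0) := rfl
        rw [flat_append, arcs_append, hstart, rungs_append, zero_add, hz, lowerBlocks,
          upperBlocks]
        simp only [flat_cons, arcs_block, rungs_append, rungs_run, rungs_inl_cons, zero_add]
        rw [rungs_decorate _ _ _ _ _ _ _ _ hT, rungs_decorate _ _ _ _ _ _ _ _ (by simp), hc]
        simp only [Finset.mem_compl, Finset.mem_insert, Finset.mem_singleton]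
        simp only [List.count_cons, List.count_nil] at hc ⊢
        by_cases h0 : y = 0
        · simp only [h0, hne.symm, if_true, if_false, true_or, not_true]
          simp only [Finset.notMem_empty, if_false]
          omega
        · by_cases h1 : y = a i₀
          · simp only [h1, hne, if_true, if_false, or_true, not_true]
            simp only [Finset.notMem_empty, if_false]
            omega
          · simp [h0, h1]
      have he : ∀ e : ZMod 2, e = 0 ∨ e = 1 := by decide
      rw [rungs] at hrung
      rcases he e with rfl | rfl
      · simpa using hrung
      · rw [splitStep_inr, Prod.mk_add_mk, add_zero, two, add_comm]
        exact hrung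
  · apply closed_of_split
    rw [flat_append, List.map_append, List.sum_append, sum_flat, sum_flat, sum_lowerBlocks _ hT hcard, sum_upperBlocks, wlow, wup,
      h.closed]
    refine Prod.ext (by simp) ?_
    simp only [List.map_cons, List.map_nil, List.sum_cons, List.sum_nil, Prod.mk_add_mk,
      Prod.snd_zero, add_zero]
    -- Over the two halves together, the contributions of `r₁`, `r₂`, `r₃` and `rs` each occur
    -- twice.
    rw [← ZModModule.add_self
      (unitVec r₁ + unitVec r₂ + (unitVec r₃ + (rs.map (unitVec (ι := κ))).sum))]
    abel
  · apply simple_of_split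
    have hD : (r₂ :: r₃ :: rs).Nodup := hR.of_cons
    have hz : (0 : (ι → ZMod 2) × (κ → ZMod 2)) = (0, 0) := rfl
    rw [flat_append, points_append, sum_flat, sum_lowerBlocks _ hT hcard, wlow, h.closed, zero_add, hz,
      List.nodup_append']
    refine ⟨nodup_points_flat _ _ (by rw [wlow]; exact h.simple) ?_,
      nodup_points_flat _ _ (by rw [wup]; exact h.simple) ?_, disjoint_halves h.simple hR⟩
    · intro b hb p
      apply nodup_stops
      simp only [lowerBlocks, List.mem_cons] at hb
      rcases hb with rfl | rfl | hb
      · exact hD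
      · exact hR.sublist (by simp)
      · rcases fst_eq_of_mem_decorate hb with h1 | h1 <;> rw [h1]
        · exact hR
        · exact List.nodup_nil
    · intro b hb p
      apply nodup_stops
      simp only [upperBlocks, List.mem_cons] at hb
      rcases hb with rfl | rfl | hb
      · simp
      · exact hD.of_cons
      · rcases fst_eq_of_mem_decorate hb with h1 | h1 <;> rw [h1] <;> exact List.nodup_nil

end Double

/-! ### Existence of tours by induction. -/

/-- There is a tour with `n` labels in an elementary abelian group of order `2 ^ (r + 1)`. -/
def HasTour (n r : ℕ) : Prop :=
  ∃ (ι A : Type) (_ : Fintype ι) (_ : DecidableEq ι) (_ : AddCommGroup A) (_ : Module (ZMod 2) A)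
    (_ : Fintype A) (_ : DecidableEq A) (a : ι → A) (w : List ι),
    Fintype.card ι = n ∧ Fintype.card A = 2 ^ (r + 1) ∧ IsTour a w

theorem HasTour.add_two {n r : ℕ} (hn : 0 < n) (h : HasTour n r) : HasTour (n + 2) r := by
  obtain ⟨ι, A, _, _, _, _, _, _, a, w, hι, hA, ht⟩ := h
  have : Nonempty ι := Fintype.card_pos_iff.1 (by omega)
  obtain ⟨j⟩ := this
  exact ⟨ι ⊕ Bool, A, inferInstance, inferInstance, inferInstance, inferInstance, inferInstance,
    inferInstance, _, _, by simp [hι], hA, ht.addPair j⟩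

theorem HasTour.double {n r : ℕ} (hn : 4 ≤ n) (hev : Even n) (h : HasTour n r) :
    HasTour (2 * n) (r + 1) := by
  obtain ⟨ι, A, _, _, _, _, _, _, a, w, hι, hA, ht⟩ := h
  have hA' : Even (Fintype.card A) := by
    rw [hA, pow_succ]
    exact even_two.mul_left _
  have hlen := ht.two_mul_length
  have hR := Finset.nodup_toList (Finset.univ : Finset ι)
  have hall : ∀ j, j ∈ (Finset.univ : Finset ι).toList := by simp
  have hRlen : (Finset.univ : Finset ι).toList.length = n := by simp [hι]
  generalize (Finset.univ : Finset ι).toList = R at hR hall hRlen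
  obtain _ | ⟨r₁, _ | ⟨r₂, _ | ⟨r₃, rs⟩⟩⟩ := R
  iterate 3 simp at hRlen; omega
  have h1 : 1 ≤ 2 ^ r := Nat.one_le_two_pow
  have h2 : 2 ≤ w.length := by
    rw [hA, hι, pow_succ] at hlen
    nlinarith
  obtain _ | ⟨i₀, _ | ⟨i₁, l⟩⟩ := w
  · simp at h2
  · simp at h2
  refine ⟨ι ⊕ ι, A × ZMod 2, inferInstance, inferInstance, inferInstance, inferInstance,
    inferInstance, inferInstance, _, _, by simp [hι, two_mul], ?_, ht.double hA' hR hall ?_⟩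
  · rw [Fintype.card_prod, hA, ZMod.card, ← pow_succ]
  · simp only [List.length_cons] at hRlen
    rw [← hRlen] at hev
    by_contra hc
    rw [Nat.not_odd_iff_even] at hc
    rcases hev with ⟨k, hk⟩
    rcases hc with ⟨k', hk'⟩
    omega

theorem hasTour_two : HasTour 2 1 :=
  ⟨Fin 2, ZMod 2 × ZMod 2, inferInstance, inferInstance, inferInstance, inferInstance,
    inferInstance, inferInstance, ![(1, 0), (0, 1)], [0, 1, 0, 1], by simp, by simp,
    ⟨by decide, by decide, by decide, by decide⟩⟩

/-- Doubling needs three distinct labels `r₁`, `r₂`, `r₃`, so this case cannot be obtained from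
`hasTour_two` and is given explicitly. -/
theorem hasTour_four : HasTour 4 2 :=
  ⟨Fin 4, ZMod 2 × ZMod 2 × ZMod 2, inferInstance, inferInstance, inferInstance, inferInstance,
    inferInstance, inferInstance, ![(1, 0, 0), (0, 1, 0), (0, 0, 1), (1, 1, 0)],
    [0, 1, 0, 3, 2, 0, 2, 1, 2, 3, 1, 0, 1, 3, 2, 3], by simp, by simp,
    ⟨by decide, by decide, by decide, by decide⟩⟩

theorem hasTour_pow (r : ℕ) (hr : 1 ≤ r) : HasTour (2 ^ r) r := by
  induction r, hr using Nat.le_induction with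
  | base => exact hasTour_two
  | succ r hr ih =>
    rcases Nat.eq_or_lt_of_le hr with rfl | h
    · exact hasTour_four
    · rw [pow_succ, mul_comm]
      refine ih.double ?_ ((Nat.even_pow' (by omega)).2 even_two)
      calc 4 = 2 ^ 2 := rfl
        _ ≤ 2 ^ r := Nat.pow_le_pow_right (by omega) h

theorem hasTour_of_le {n r : ℕ} (hr : 1 ≤ r) (hn : Even n) (h : 2 ^ r ≤ n) : HasTour n r := by
  have hpow : Even (2 ^ r) := (Nat.even_pow' (by omega)).2 even_two
  obtain ⟨k, hk⟩ : ∃ k, n = 2 ^ r + 2 * k := by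
    obtain ⟨k, hk⟩ := (Nat.even_sub h).2 (by simp [hn, hpow])
    exact ⟨k, by omega⟩
  subst hk
  clear h hn
  induction k with
  | zero => exact hasTour_pow r hr
  | succ k ih => exact ih.add_two (Nat.add_pos_left (by positivity) _)

end CubeDecomposition

theorem corollary1p2 (n m : ℕ) (hn : 2 ≤ n) (heven : Even n)
    (hm : IsGreatest {k : ℕ | 2 ^ k ≤ n} m) :
    ∀ r : ℕ, 1 ≤ r → r ≤ m →
      CubeDecomposition.DecomposesInto (CubeDecomposition.cube n)
        (SimpleGraph.cycleGraph (2 ^ r * n)) := by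
  intro r hr hrm
  obtain ⟨ι, A, _, _, _, _, _, _, a, w, hι, hA, ht⟩ :=
    CubeDecomposition.hasTour_of_le hr heven
      ((Nat.pow_le_pow_right (by omega) hrm).trans hm.1)
  have hlen : w.length = 2 ^ r * n := by
    have h := ht.two_mul_length
    rw [hA, hι, pow_succ] at h
    linarith
  have hpow : 2 ^ 1 ≤ 2 ^ r := Nat.pow_le_pow_right (by omega) hr
  rw [← hlen]
  exact ht.decomposesInto (by rw [hlen]; nlinarith) (Fintype.equivFinOfCardEq hι).symm
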